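/- Let $S=\mathbb{K}[x_1,\ldots,x_n]$ be a polynomial ring over an arbitrary field $\mathbb{K}$, let $Q$ be a partial order on $\{x_1,\ldots,x_n\}$ and let $m\in S$ be a monomial. A monomial ideal $J\subseteq S$ is called $Q$-Borel if $x_j\cdot (u/x_i)\in J$ whenever $u\in J$ is a monomial, $x_i\mid u$ and $x_j\leq_Q x_i$. Let $I=Q(m)$ be the smallest $Q$-Borel ideal containing $m$. For $d\ge 1$ let $I^{(d)}=\bigcap_{P\in \mathrm{ass}(I)}(I^dS_P\cap S)$ be the $d$-th symbolic power of $I$, where $\mathrm{ass}(I)$ is the set of all associated primes of $I$ (that is, of $S/I$) and the empty intersection is $S$. Then: 1. the Waldschmidt constant of $I$ is $\deg(m)$, i.e. the limit $\widehat{\alpha}(I)=\lim_{s\to\infty}\alpha(I^{(s)})/s$ exists and equals $\deg(m)$, where $\alpha(J)$ denotes the smallest degree of an element in a minimal set of homogeneous generators of a nonzero homogeneous ideal $J$; 2. for all $d\geq 1$ the symbolic defect $\mathrm{sdefect}(I,d)$, i.e. the minimal number of generators of the $S$-module $I^{(d)}/I^d$, is $0$; 3. if $m\neq 1$, the resurgence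 $\rho(I)=\sup\{s/r \mid s,r\geq 1,\ I^{(s)}\not\subseteq I^r\}$ is $1$. -/

import Mathlib

open MvPolynomial Filter Topology

namespace QBorel

/-! Throughout, `σ` is the finite set of variables, a partial order on `σ` is the poset `Q`,
and the exponent vector `a : σ →₀ ℕ` stands for the monomial `x ^ a = monomial a 1`. -/

section Ideals

variable {K : Type*} [Field K] {σ : Type*}

/-- A monomial ideal: an ideal generated by monomials. -/
def IsMonomialIdeal (I : Ideal (MvPolynomial σ K)) : Prop :=
  ∃ A : Set (σ →₀ ℕ), I = Ideal.span ((fun a => monomial a (1 : K)) '' A)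

/-- A `Q`-Borel ideal: a monomial ideal such that `x_j * (x ^ a / x_i)` lies in `I` whenever
`x ^ a` is a monomial of `I`, `x_i` divides `x ^ a` and `x_j ≤ x_i` in the poset. -/
def IsQBorel [PartialOrder σ] (I : Ideal (MvPolynomial σ K)) : Prop :=
  IsMonomialIdeal I ∧
    ∀ a : σ →₀ ℕ, monomial a (1 : K) ∈ I → ∀ i j : σ, a i ≠ 0 → j ≤ i →
      monomial (a - Finsupp.single i 1 + Finsupp.single j 1) (1 : K) ∈ I

variable (K) in
/-- The principal `Q`-Borel ideal `Q(m)`: the smallest `Q`-Borel ideal containing `x ^ m`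
(see `isLeast_principalQBorel`). -/
noncomputable def principalQBorel [PartialOrder σ] (m : σ →₀ ℕ) : Ideal (MvPolynomial σ K) :=
  sInf {I | IsQBorel I ∧ monomial m (1 : K) ∈ I}

theorem isMonomialIdeal_iff {I : Ideal (MvPolynomial σ K)} :
    IsMonomialIdeal I ↔ ∀ f ∈ I, ∀ a ∈ f.support, monomial a (1 : K) ∈ I := by
  constructor
  · rintro ⟨A, rfl⟩ f hf a ha
    obtain ⟨b, hb, hba⟩ := mem_ideal_span_monomial_image.1 hf a ha
    refine mem_ideal_span_monomial_image.2 fun c hc => ⟨b, hb, ?_⟩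
    obtain rfl : c = a := by
      have := support_monomial_subset hc
      simpa using this
    exact hba
  · intro h
    refine ⟨{a | monomial a (1 : K) ∈ I}, le_antisymm (fun f hf => ?_) (Ideal.span_le.2 ?_)⟩
    · exact mem_ideal_span_monomial_image.2 fun a ha => ⟨a, h f hf a ha, le_rfl⟩
    · rintro _ ⟨a, ha, rfl⟩
      exact ha

/-- `Q(m)` is indeed the least `Q`-Borel ideal containing `x ^ m`. -/
theorem isLeast_principalQBorel [PartialOrder σ] (m : σ →₀ ℕ) :
    IsLeast {I : Ideal (MvPolynomial σ K) | IsQBorel I ∧ monomial m (1 : K) ∈ I}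
      (principalQBorel K m) := by
  refine ⟨⟨⟨isMonomialIdeal_iff.2 fun f hf a ha => ?_, fun a ha i j hi hij => ?_⟩, ?_⟩,
    fun J hJ => sInf_le hJ⟩
  · exact Submodule.mem_sInf.2 fun J hJ =>
      isMonomialIdeal_iff.1 hJ.1.1 f (Submodule.mem_sInf.1 hf J hJ) a ha
  · exact Submodule.mem_sInf.2 fun J hJ =>
      hJ.1.2 a (Submodule.mem_sInf.1 ha J hJ) i j hi hij
  · exact Submodule.mem_sInf.2 fun J hJ => hJ.2

end Ideals

section Symbolic

variable {S : Type*} [CommRing S]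

/-- The `d`-th symbolic power `I ^ (d) = ⋂ (I ^ d S_P ∩ S)`, the intersection being over all
associated primes `P` of `I`, that is, of the module `S ⧸ I`. -/
noncomputable def symbolicPower (I : Ideal S) (d : ℕ) : Ideal S :=
  ⨅ P : associatedPrimes S (S ⧸ I),
    haveI : P.1.IsPrime := P.2.1
    ((I ^ d).map (algebraMap S (Localization.AtPrime P.1))).comap
      (algebraMap S (Localization.AtPrime P.1))

/-- The `d`-th symbolic defect: the minimal number of generators of the `S`-module
`I ^ (d) / I ^ d`. -/
noncomputable def symbolicDefect (I : Ideal S) (d : ℕ) : Cardinal :=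
  (⊤ : Submodule S (symbolicPower I d ⧸ (I ^ d).submoduleOf (symbolicPower I d))).spanRank

/-- The resurgence `sup {s / r | I ^ (s) ⊄ I ^ r}`, with `s` and `r` positive integers; the
supremum is taken in the extended reals. -/
noncomputable def resurgence (I : Ideal S) : EReal :=
  sSup {q : EReal | ∃ s r : ℕ, 1 ≤ s ∧ 1 ≤ r ∧ ¬ symbolicPower I s ≤ I ^ r ∧
    q = (((s : ℝ) / (r : ℝ) : ℝ) : EReal)}

end Symbolic

section Waldschmidt

variable {K : Type*} [Field K] {σ : Type*}

/-- `G` is a minimal set of homogeneous generators of the ideal `I`. -/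
def IsMinimalHomogeneousGenerators (I : Ideal (MvPolynomial σ K))
    (G : Set (MvPolynomial σ K)) : Prop :=
  (∀ g ∈ G, ∃ d : ℕ, g.IsHomogeneous d) ∧ Ideal.span G = I ∧
    ∀ G' : Set (MvPolynomial σ K), G' ⊂ G → Ideal.span G' ≠ I

/-- `α(I)`: the smallest degree of an element in a minimal set of homogeneous generators of the
(nonzero homogeneous) ideal `I`. -/
noncomputable def initialDegree (I : Ideal (MvPolynomial σ K)) : ℕ :=
  sInf {d : ℕ | ∃ G : Set (MvPolynomial σ K), IsMinimalHomogeneousGenerators I G ∧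
    ∃ g ∈ G, g.totalDegree = d}

/-- `c` is the Waldschmidt constant of `I`: the limit of `α(I ^ (s)) / s` exists and equals `c`. -/
def IsWaldschmidtConstant (I : Ideal (MvPolynomial σ K)) (c : ℝ) : Prop :=
  Tendsto (fun s : ℕ => (initialDegree (symbolicPower I s) : ℝ) / (s : ℝ)) atTop (𝓝 c)

end Waldschmidt

end QBorel

/-! Write `x ^ m` as a product of variables `x_i` with repetition. Borel moves act on each factor
separately, so `Q(m)` is the product of the primes `P_i = (x_j : j ≤ i)`
(`principalQBorel_eq_lowerProduct`).

Everything follows from `I ^ (d) = I ^ d`. Group the factors into blocks with pairwise disjoint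
variable sets, the factors of each block being linked by shared variables. The variables of a block
`M` generate an associated prime of `I` (`IsConnector.mem_associatedPrimes`), and elements outside
that prime are nonzerodivisors modulo any power of the block's product
(`IsGeneratedIn.mem_of_mul_mem`). Hence `I ^ (d)` lies in the `d`-th power of every block product.
Since the blocks share no variables, the intersection of these powers is their product, `I ^ d`.

As `I ^ d` is generated in degree `d * deg m`, the invariants reduce to degree counts. -/

namespace QBorel

/-! ### Ideals generated by monomials of one degree in given variables -/

section GeneratedIn

variable {K : Type*} [Field K] {σ : Type*} {V W : Set σ} {N N' : ℕ}
  {I J : Ideal (MvPolynomial σ K)}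

/-- `J` is generated by monomials of degree `N` in the variables from `V`. -/
def IsGeneratedIn (V : Set σ) (N : ℕ) (J : Ideal (MvPolynomial σ K)) : Prop :=
  ∃ A : Set (σ →₀ ℕ), (∀ a ∈ A, (∀ i, a i ≠ 0 → i ∈ V) ∧ a.degree = N) ∧
    J = Ideal.span ((fun a => monomial a (1 : K)) '' A)

theorem monomial_mem_span_iff {A : Set (σ →₀ ℕ)} {a : σ →₀ ℕ} :
    monomial a (1 : K) ∈ Ideal.span ((fun a => monomial a (1 : K)) '' A) ↔ ∃ b ∈ A, b ≤ a := by
  classical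
  rw [mem_ideal_span_monomial_image, support_monomial, if_neg one_ne_zero]
  simp

theorem monomial_mem_of_le {a b : σ →₀ ℕ} (hab : a ≤ b) (ha : monomial a (1 : K) ∈ J) :
    monomial b (1 : K) ∈ J := by
  obtain ⟨c, rfl⟩ := exists_add_of_le hab
  simpa [monomial_mul] using J.mul_mem_right (monomial c (1 : K)) ha

theorem IsMonomialIdeal.mem_iff (hJ : IsMonomialIdeal J) {f : MvPolynomial σ K} :
    f ∈ J ↔ ∀ a ∈ f.support, monomial a (1 : K) ∈ J := by
  obtain ⟨A, rfl⟩ := hJ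
  rw [mem_ideal_span_monomial_image]
  exact forall₂_congr fun a _ => monomial_mem_span_iff.symm

theorem span_monomial_mul_span_monomial (A B : Set (σ →₀ ℕ)) :
    Ideal.span ((fun a => monomial a (1 : K)) '' A) *
      Ideal.span ((fun a => monomial a (1 : K)) '' B) =
    Ideal.span ((fun a => monomial a (1 : K)) '' (Set.image2 (· + ·) A B)) := by
  rw [Ideal.span_mul_span', ← Set.image2_mul, Set.image2_image_left, Set.image2_image_right,
    Set.image_image2]
  simp only [monomial_mul, mul_one]

namespace IsGeneratedIn

theorem isMonomialIdeal (hJ : IsGeneratedIn V N J) : IsMonomialIdeal J :=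
  let ⟨A, _, hA⟩ := hJ; ⟨A, hA⟩

theorem mono (hJ : IsGeneratedIn V N J) (h : V ⊆ W) : IsGeneratedIn W N J :=
  let ⟨A, h1, hA⟩ := hJ
  ⟨A, fun a ha => ⟨fun i hi => h ((h1 a ha).1 i hi), (h1 a ha).2⟩, hA⟩

theorem top (V : Set σ) : IsGeneratedIn V 0 (1 : Ideal (MvPolynomial σ K)) := by
  refine ⟨{0}, by simp, ?_⟩
  rw [Set.image_singleton, Ideal.one_eq_top]
  exact Ideal.span_singleton_one.symm

theorem mul (hI : IsGeneratedIn V N I) (hJ : IsGeneratedIn V N' J) :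
    IsGeneratedIn V (N + N') (I * J) := by
  obtain ⟨A, hA, rfl⟩ := hI
  obtain ⟨B, hB, rfl⟩ := hJ
  refine ⟨_, ?_, span_monomial_mul_span_monomial A B⟩
  rintro _ ⟨a, ha, b, hb, rfl⟩
  refine ⟨fun i hi => ?_, by rw [map_add, (hA a ha).2, (hB b hb).2]⟩
  by_cases h : a i = 0
  · exact (hB b hb).1 i fun h' => hi (by simp [h, h'])
  · exact (hA a ha).1 i h

theorem pow (hI : IsGeneratedIn V N I) (d : ℕ) : IsGeneratedIn V (d * N) (I ^ d) := by
  induction d with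
  | zero => simpa using top V
  | succ d ih => rw [pow_succ, Nat.succ_mul]; exact ih.mul hI

theorem le_degree (hJ : IsGeneratedIn V N J) {a : σ →₀ ℕ} (ha : monomial a (1 : K) ∈ J) :
    N ≤ a.degree := by
  obtain ⟨A, hA, rfl⟩ := hJ
  obtain ⟨b, hb, hba⟩ := monomial_mem_span_iff.1 ha
  rw [← (hA b hb).2]
  exact Finsupp.degree_mono hba

theorem monomial_mem_of_add (hJ : IsGeneratedIn V N J) {a b : σ →₀ ℕ} (ha : ∀ v ∈ V, a v = 0)
    (h : monomial (a + b) (1 : K) ∈ J) : monomial b (1 : K) ∈ J := by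
  obtain ⟨A, hA, rfl⟩ := hJ
  obtain ⟨c, hc, hcab⟩ := monomial_mem_span_iff.1 h
  refine monomial_mem_span_iff.2 ⟨c, hc, fun i => ?_⟩
  by_cases hi : c i = 0
  · simp [hi]
  · simpa [ha i ((hA c hc).1 i hi)] using hcab i

/-- Modulo an ideal generated by monomials in the variables from `V`, every element outside the
ideal generated by these variables is a nonzerodivisor. -/
theorem mem_of_mul_mem (hJ : IsGeneratedIn V N J) {s f : MvPolynomial σ K}
    (hs : s ∉ Ideal.span (X '' V : Set (MvPolynomial σ K))) (hsf : s * f ∈ J) : f ∈ J := by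
  classical
  by_contra hf
  -- The degree in the variables of `V`. The relevant terms are those of `s` with `w = 0` and, among
  -- the terms of `f` outside `J`, those of least `w`.
  let w : (σ →₀ ℕ) →+ ℕ := Finsupp.weight (V.indicator 1)
  have hw : ∀ a, w a = 0 ↔ ∀ v ∈ V, a v = 0 := by
    refine fun a => ⟨fun h v hv => ?_, fun h => ?_⟩
    · have := Finsupp.le_weight (V.indicator (1 : σ → ℕ)) (s := v) (by simp [hv]) a
      exact Nat.eq_zero_of_le_zero (this.trans h.le)
    · change Finsupp.weight _ a = 0
      rw [Finsupp.weight_apply]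
      refine Finset.sum_eq_zero fun v _ => ?_
      by_cases hv : v ∈ V
      · simp [h v hv]
      · simp [hv]
  have hA : (s.support.filter fun a => w a = 0).Nonempty := by
    rw [mem_ideal_span_X_image] at hs
    push Not at hs
    obtain ⟨a, ha, h⟩ := hs
    exact ⟨a, Finset.mem_filter.2 ⟨ha, (hw a).2 h⟩⟩
  have hT : (f.support.filter fun b => monomial b (1 : K) ∉ J).Nonempty := by
    rw [hJ.isMonomialIdeal.mem_iff] at hf
    push Not at hf
    obtain ⟨b, hb, h⟩ := hf
    exact ⟨b, Finset.mem_filter.2 ⟨hb, h⟩⟩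
  obtain ⟨b1, hb1, hmin⟩ := Finset.exists_min_image _ w hT
  have hB : (f.support.filter fun b => monomial b (1 : K) ∉ J ∧ w b = w b1).Nonempty :=
    ⟨b1, by simpa using hb1⟩
  -- A sum attained only once cannot cancel; terms of `f` inside `J` or of larger `w` cannot
  -- contribute to it either.
  obtain ⟨a0, ha0, b0, hb0, huniq⟩ := UniqueSums.uniqueAdd_of_nonempty hA hB
  obtain ⟨ha0s, ha0w⟩ := Finset.mem_filter.1 ha0
  obtain ⟨hb0f, hb0J, hb0w⟩ := Finset.mem_filter.1 hb0
  have hab : monomial (a0 + b0) (1 : K) ∉ J := fun h =>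
    hb0J (hJ.monomial_mem_of_add ((hw a0).1 ha0w) h)
  have hcoeff : coeff (a0 + b0) (s * f) = coeff a0 s * coeff b0 f := by
    rw [coeff_mul]
    refine Finset.sum_eq_single (a0, b0) (fun x hx hne => ?_) (fun h => absurd (by simp) h)
    obtain ⟨a, b⟩ := x
    rw [Finset.HasAntidiagonal.mem_antidiagonal] at hx
    by_contra hne0
    have has : a ∈ s.support := mem_support_iff.2 (left_ne_zero_of_mul hne0)
    have hbf : b ∈ f.support := mem_support_iff.2 (right_ne_zero_of_mul hne0)
    have hbJ : monomial b (1 : K) ∉ J := fun h =>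
      hab (monomial_mem_of_le (hx ▸ self_le_add_left b a) h)
    have h1 := hmin b (Finset.mem_filter.2 ⟨hbf, hbJ⟩)
    have h2 : w a + w b = w a0 + w b0 := by rw [← map_add, ← map_add]; exact congrArg w hx
    obtain ⟨rfl, rfl⟩ := huniq (Finset.mem_filter.2 ⟨has, by omega⟩)
      (Finset.mem_filter.2 ⟨hbf, hbJ, by omega⟩) hx
    exact hne rfl
  refine hab (hJ.isMonomialIdeal.mem_iff.1 hsf _ (mem_support_iff.2 ?_))
  rw [hcoeff]
  exact mul_ne_zero (mem_support_iff.1 ha0s) (mem_support_iff.1 hb0f)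

/-- Generators in disjoint variables are coprime, so a monomial divisible by both is divisible by
their product. -/
theorem inf_le_mul (hI : IsGeneratedIn V N I) (hJ : IsGeneratedIn W N' J) (h : Disjoint V W) :
    I ⊓ J ≤ I * J := by
  obtain ⟨A, hA, rfl⟩ := hI
  obtain ⟨B, hB, rfl⟩ := hJ
  intro f ⟨hf1, hf2⟩
  rw [span_monomial_mul_span_monomial, mem_ideal_span_monomial_image]
  intro c hc
  obtain ⟨a, ha, hac⟩ := mem_ideal_span_monomial_image.1 hf1 c hc
  obtain ⟨b, hb, hbc⟩ := mem_ideal_span_monomial_image.1 hf2 c hc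
  refine ⟨a + b, ⟨a, ha, b, hb, rfl⟩, fun i => ?_⟩
  by_cases hi : a i = 0
  · simpa [hi] using hbc i
  · have hbi : b i = 0 := by
      by_contra h0
      exact Set.disjoint_left.1 h ((hA a ha).1 i hi) ((hB b hb).1 i h0)
    simpa [hbi] using hac i

theorem initialDegree_eq (hJ : IsGeneratedIn V N J) (h0 : J ≠ ⊥) : initialDegree J = N := by
  have hJ' := hJ
  obtain ⟨A, hA, hJA⟩ := hJ'
  refine le_antisymm (Nat.sInf_le ?_) (le_csInf ?_ ?_)
  on_goal 2 => refine ⟨N, ?_⟩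
  on_goal 3 =>
    rintro d ⟨G, ⟨-, hspan, hmin⟩, g, hg, rfl⟩
    have hg0 : g ≠ 0 := by
      rintro rfl
      refine hmin (G \ {0}) ⟨Set.sdiff_subset, fun h => (h hg).2 rfl⟩ ?_
      rw [Ideal.span_sdiff_singleton_zero, hspan]
    obtain ⟨a, ha⟩ := support_nonempty.2 hg0
    refine (hJ.le_degree (hJ.isMonomialIdeal.mem_iff.1 ?_ a ha)).trans (le_totalDegree ha)
    rw [← hspan]
    exact Ideal.subset_span hg
  -- The monomial generators serve both for the upper bound and for nonemptiness of the set of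
  -- degrees. They are minimal because a monomial dividing another of equal degree equals it.
  all_goals
    obtain ⟨a, ha⟩ : A.Nonempty := by
      rw [Set.nonempty_iff_ne_empty]
      rintro rfl
      exact h0 (by simpa using hJA)
    refine ⟨(fun a => monomial a (1 : K)) '' A, ⟨?_, hJA.symm, ?_⟩, _, ⟨a, ha, rfl⟩, ?_⟩
    · rintro _ ⟨b, hb, rfl⟩
      exact ⟨_, isHomogeneous_monomial _ rfl⟩
    · intro G' hG' hspan
      obtain ⟨_, ⟨b, hb, rfl⟩, hbG⟩ := Set.exists_of_ssubset hG'
      have hG : G' = (fun a => monomial a (1 : K)) '' {a ∈ A | monomial a (1 : K) ∈ G'} := by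
        ext g
        constructor
        · intro hg
          obtain ⟨c, hc, rfl⟩ := hG'.1 hg
          exact ⟨c, ⟨hc, hg⟩, rfl⟩
        · rintro ⟨c, hc, rfl⟩
          exact hc.2
      have hbJ : monomial b (1 : K) ∈ Ideal.span G' := by
        rw [hspan, hJA]
        exact Ideal.subset_span ⟨b, hb, rfl⟩
      rw [hG] at hbJ
      obtain ⟨c, hc, hcb⟩ := monomial_mem_span_iff.1 hbJ
      obtain ⟨e, rfl⟩ := exists_add_of_le hcb
      have hdeg := (hA _ hb).2
      rw [map_add, (hA c hc.1).2] at hdeg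
      obtain rfl : e = 0 := (Finsupp.degree_eq_zero_iff e).1 (by omega)
      exact hbG (by simpa using hc.2)
    · rw [totalDegree_monomial _ one_ne_zero]
      exact (hA a ha).2

end IsGeneratedIn

theorem isGeneratedIn_span_X_image (V : Set σ) :
    IsGeneratedIn V 1 (Ideal.span (X '' V : Set (MvPolynomial σ K))) := by
  classical
  refine ⟨(fun i => Finsupp.single i 1) '' V, ?_, ?_⟩
  · rintro _ ⟨v, hv, rfl⟩
    refine ⟨fun i hi => ?_, Finsupp.degree_single _ _⟩
    rw [Finsupp.single_apply_ne_zero] at hi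
    exact hi.1 ▸ hv
  · rw [Set.image_image]
    rfl

/-- The nonzerodivisor statement, applied to this ideal itself, is primality. -/
theorem isPrime_span_X_image (V : Set σ) :
    (Ideal.span (X '' V : Set (MvPolynomial σ K))).IsPrime := by
  refine ⟨(Ideal.ne_top_iff_one _).2 fun h => ?_, fun {s f} hsf => or_iff_not_imp_left.2 fun hs =>
    (isGeneratedIn_span_X_image V).mem_of_mul_mem hs hsf⟩
  simpa using (isGeneratedIn_span_X_image V).le_degree (a := 0) h

end GeneratedIn

/-! ### Monomials as multisets of variables -/

section ExponentOf

variable {σ : Type*}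

/-- The exponent vector of the product of the variables in the multiset `M`. -/
noncomputable def exponentOf (M : Multiset σ) : σ →₀ ℕ := (M.map fun i => Finsupp.single i 1).sum

theorem exponentOf_cons (i : σ) (M : Multiset σ) :
    exponentOf (i ::ₘ M) = Finsupp.single i 1 + exponentOf M := by
  simp [exponentOf]

theorem exponentOf_toMultiset (m : σ →₀ ℕ) : exponentOf m.toMultiset = m := by
  induction m using Finsupp.induction_linear with
  | zero => simp [exponentOf]
  | add f g hf hg =>
    rw [exponentOf] at hf hg ⊢
    rw [map_add, Multiset.map_add, Multiset.sum_add, hf, hg]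
  | single a n => simp [exponentOf, Finsupp.toMultiset_single, Multiset.map_nsmul, Multiset.sum_nsmul]

end ExponentOf

/-! ### Products of the primes `P_i` -/

section LowerIdeals

variable {K : Type*} [Field K] {σ : Type*} [PartialOrder σ]

variable (K) in
/-- The product over `i` in the multiset `M` of the ideals generated by the variables `≤ i`. -/
noncomputable def lowerProduct (M : Multiset σ) : Ideal (MvPolynomial σ K) :=
  (M.map fun i => Ideal.span (X '' Set.Iic i : Set (MvPolynomial σ K))).prod

/-- The set of all `v` lying below a member of the multiset `M`. -/
def lowerSupport (M : Multiset σ) : Set σ := {v | ∃ i ∈ M, v ≤ i}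

theorem lowerProduct_cons (i : σ) (M : Multiset σ) :
    lowerProduct K (i ::ₘ M) = Ideal.span (X '' Set.Iic i) * lowerProduct K M := by
  simp [lowerProduct]

theorem lowerProduct_add (M N : Multiset σ) :
    lowerProduct K (M + N) = lowerProduct K M * lowerProduct K N := by
  simp [lowerProduct]

theorem lowerSupport_add (M N : Multiset σ) :
    lowerSupport (M + N) = lowerSupport M ∪ lowerSupport N := by
  ext v
  simp [lowerSupport, or_and_right, exists_or]

theorem lowerSupport_mono {M N : Multiset σ} (h : M ≤ N) : lowerSupport M ⊆ lowerSupport N :=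
  fun _ ⟨i, hi, hv⟩ => ⟨i, Multiset.mem_of_le h hi, hv⟩

theorem isGeneratedIn_lowerProduct (M : Multiset σ) :
    IsGeneratedIn (lowerSupport M) M.card (lowerProduct K M) := by
  induction M using Multiset.induction_on with
  | empty => simpa [lowerProduct] using IsGeneratedIn.top _
  | cons i M ih =>
    rw [lowerProduct_cons, Multiset.card_cons, add_comm]
    refine ((isGeneratedIn_span_X_image _).mono fun v hv => ?_).mul
      (ih.mono (lowerSupport_mono (Multiset.le_cons_self M i)))
    exact ⟨i, Multiset.mem_cons_self i M, hv⟩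

theorem monomial_exponentOf_mem (M : Multiset σ) :
    monomial (exponentOf M) (1 : K) ∈ lowerProduct K M := by
  induction M using Multiset.induction_on with
  | empty => simp [lowerProduct]
  | cons i M ih =>
    rw [lowerProduct_cons, exponentOf_cons, ← one_mul (1 : K), ← monomial_mul]
    exact Ideal.mul_mem_mul (Ideal.subset_span ⟨i, le_rfl, rfl⟩) ih

theorem exponentOf_apply_eq_zero {M : Multiset σ} {v : σ} (h : v ∉ lowerSupport M) :
    exponentOf M v = 0 := by
  induction M using Multiset.induction_on with
  | empty => simp [exponentOf]
  | cons i M ih =>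
    rw [exponentOf_cons, Finsupp.add_apply,
      ih fun h' => h (lowerSupport_mono (Multiset.le_cons_self M i) h'), add_zero,
      Finsupp.single_apply_eq_zero]
    rintro rfl
    exact absurd ⟨v, Multiset.mem_cons_self v M, le_rfl⟩ h

end LowerIdeals

/-! ### `Q(m)` as a product of primes -/

section Borel

variable {K : Type*} [Field K] {σ : Type*} [PartialOrder σ] {I J : Ideal (MvPolynomial σ K)}

theorem isQBorel_span_X_image_Iic (k : σ) :
    IsQBorel (Ideal.span (X '' Set.Iic k : Set (MvPolynomial σ K))) := by
  classical
  have hmem : ∀ a : σ →₀ ℕ, monomial a (1 : K) ∈ Ideal.span (X '' Set.Iic k) ↔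
      ∃ i ∈ Set.Iic k, a i ≠ 0 := fun a => by
    rw [mem_ideal_span_X_image, support_monomial, if_neg one_ne_zero]
    simp
  refine ⟨(isGeneratedIn_span_X_image _).isMonomialIdeal, fun a ha i j hi hij => ?_⟩
  rw [hmem] at ha ⊢
  obtain ⟨v, hv, hav⟩ := ha
  by_cases hvi : v = i
  · exact ⟨j, hij.trans (hvi ▸ hv), by simp⟩
  · refine ⟨v, hv, ?_⟩
    simp [Finsupp.single_apply_eq_zero.2 fun h => absurd h hvi, hav]

/-- The move is made inside whichever factor contains `x_i`; a surplus cofactor `e` is attached to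
`a`. -/
theorem IsQBorel.mul (hI : IsQBorel I) (hJ : IsQBorel J) : IsQBorel (I * J) := by
  obtain ⟨⟨A, rfl⟩, hI⟩ := hI
  obtain ⟨⟨B, rfl⟩, hJ⟩ := hJ
  refine ⟨⟨_, span_monomial_mul_span_monomial A B⟩, fun c hc i j hi hij => ?_⟩
  rw [span_monomial_mul_span_monomial] at hc
  obtain ⟨_, ⟨a, ha, b, hb, rfl⟩, hab⟩ := monomial_mem_span_iff.1 hc
  obtain ⟨e, rfl⟩ := exists_add_of_le hab
  have ha' : monomial (a + e) (1 : K) ∈ Ideal.span ((fun a => monomial a (1 : K)) '' A) :=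
    monomial_mem_span_iff.2 ⟨a, ha, self_le_add_right a e⟩
  have hb' : monomial b (1 : K) ∈ Ideal.span ((fun a => monomial a (1 : K)) '' B) :=
    monomial_mem_span_iff.2 ⟨b, hb, le_rfl⟩
  by_cases h : b i = 0
  · have h1 : (a + e) i ≠ 0 := by simpa [h] using hi
    have h2 := Ideal.mul_mem_mul (hI _ ha' i j h1 hij) hb'
    rw [monomial_mul, one_mul] at h2
    convert h2 using 3
    have h3 : Finsupp.single i 1 ≤ a + e := by
      rw [Finsupp.single_le_iff]; exact Nat.one_le_iff_ne_zero.2 h1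
    rw [show a + b + e = a + e + b by abel, ← tsub_add_eq_add_tsub h3, add_right_comm]
  · have h2 := Ideal.mul_mem_mul ha' (hJ _ hb' i j h hij)
    rw [monomial_mul, one_mul] at h2
    convert h2 using 3
    have h3 : Finsupp.single i 1 ≤ b := by
      rw [Finsupp.single_le_iff]; exact Nat.one_le_iff_ne_zero.2 h
    rw [show a + b + e = a + e + b by abel, add_tsub_assoc_of_le h3, add_assoc]

theorem isQBorel_lowerProduct (M : Multiset σ) : IsQBorel (lowerProduct K M) := by
  induction M using Multiset.induction_on with
  | empty => exact ⟨(isGeneratedIn_lowerProduct _).isMonomialIdeal, by simp [lowerProduct]⟩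
  | cons i M ih =>
    rw [lowerProduct_cons]
    exact (isQBorel_span_X_image_Iic i).mul ih

/-- Variables of `M` are lowered one at a time by Borel moves; `c` collects those already lowered,
so it varies in the induction. -/
theorem IsQBorel.monomial_mul_mem (hJ : IsQBorel J) {M : Multiset σ} {c : σ →₀ ℕ}
    (hc : monomial (c + exponentOf M) (1 : K) ∈ J) {f : MvPolynomial σ K}
    (hf : f ∈ lowerProduct K M) : monomial c (1 : K) * f ∈ J := by
  induction M using Multiset.induction_on generalizing c f with
  | empty =>
    refine J.mul_mem_right f ?_
    simpa [exponentOf] using hc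
  | cons i M ih =>
    rw [lowerProduct_cons] at hf
    refine Submodule.mul_induction_on hf (fun p hp q hq => ?_) fun x y hx hy => ?_
    · induction hp using Submodule.span_induction with
      | zero => simp
      | add x y _ _ hx hy => rw [add_mul, mul_add]; exact J.add_mem hx hy
      | smul a x _ hx =>
        rw [smul_eq_mul, mul_assoc, mul_left_comm]
        exact J.mul_mem_left a hx
      | mem x hx =>
        obtain ⟨v, hv, rfl⟩ := hx
        rw [← mul_assoc, X, monomial_mul, one_mul]
        refine ih ?_ hq
        convert hJ.2 _ hc i v (by simp [exponentOf_cons]) hv using 3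
        rw [exponentOf_cons, add_left_comm, add_tsub_cancel_left]
        abel
    · rw [mul_add]
      exact J.add_mem hx hy

variable (K) in
theorem principalQBorel_eq_lowerProduct (m : σ →₀ ℕ) :
    principalQBorel K m = lowerProduct K m.toMultiset := by
  refine le_antisymm (sInf_le ⟨isQBorel_lowerProduct _, ?_⟩) fun f hf => ?_
  · simpa only [exponentOf_toMultiset] using monomial_exponentOf_mem (K := K) m.toMultiset
  · obtain ⟨h1, h2⟩ := (isLeast_principalQBorel (K := K) m).1
    rw [← one_mul f]
    refine h1.monomial_mul_mem (c := 0) ?_ hf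
    rwa [zero_add, exponentOf_toMultiset]

end Borel

/-! ### Linked blocks, their associated primes and symbolic powers -/

section Blocks

variable {K : Type*} [Field K] {σ : Type*} [PartialOrder σ]

variable (K) in
/-- `x ^ c` has degree one less than the generators of `lowerProduct K M`, and multiplying it by
any variable that occurs in these generators gives an element of `lowerProduct K M`. -/
def IsConnector (M : Multiset σ) (c : σ →₀ ℕ) : Prop :=
  c.degree + 1 = M.card ∧
    ∀ v ∈ lowerSupport M, monomial (c + Finsupp.single v 1) (1 : K) ∈ lowerProduct K M

variable (K) in
theorem isConnector_singleton (i : σ) : IsConnector K {i} 0 := by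
  refine ⟨by simp, fun v hv => ?_⟩
  obtain ⟨j, hj, hvj⟩ := hv
  rw [Multiset.mem_singleton] at hj
  rw [zero_add, lowerProduct, Multiset.map_singleton, Multiset.prod_singleton]
  exact Ideal.subset_span ⟨v, hj ▸ hvj, rfl⟩

/-- A variable `v` completes the connector of its own side, and the shared variable `w` completes
the other. -/
theorem IsConnector.add {M N : Multiset σ} {c d : σ →₀ ℕ} (hc : IsConnector K M c)
    (hd : IsConnector K N d) {w : σ} (hM : w ∈ lowerSupport M) (hN : w ∈ lowerSupport N) :
    IsConnector K (M + N) (c + d + Finsupp.single w 1) := by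
  refine ⟨?_, fun v hv => ?_⟩
  · rw [map_add, map_add, Finsupp.degree_single, Multiset.card_add, ← hc.1, ← hd.1]
    abel
  · rw [lowerProduct_add]
    rw [lowerSupport_add] at hv
    rcases hv with hv | hv
    · have := Ideal.mul_mem_mul (hc.2 v hv) (hd.2 w hN)
      rw [monomial_mul, one_mul] at this
      convert this using 3
      abel
    · have := Ideal.mul_mem_mul (hc.2 w hM) (hd.2 v hv)
      rw [monomial_mul, one_mul] at this
      convert this using 3
      abel

/-- A factor of `R` meeting the block is absorbed into it until none is left. -/
theorem IsConnector.exists_disjoint {M : Multiset σ} {c : σ →₀ ℕ} (hc : IsConnector K M c)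
    (R : Multiset σ) : ∃ M' R' c', M' + R' = M + R ∧ IsConnector K M' c' ∧
      Disjoint (lowerSupport M') (lowerSupport R') := by
  induction hn : R.card generalizing M R c with
  | zero =>
    obtain rfl := Multiset.card_eq_zero.1 hn
    exact ⟨M, 0, c, rfl, hc, by simp [lowerSupport]⟩
  | succ n ih =>
    by_cases hd : Disjoint (lowerSupport M) (lowerSupport R)
    · exact ⟨M, R, c, rfl, hc, hd⟩
    · obtain ⟨w, hwM, k, hk, hwk⟩ := Set.not_disjoint_iff.1 hd
      obtain ⟨R, rfl⟩ := Multiset.exists_cons_of_mem hk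
      obtain ⟨M', R', c', h, h'⟩ := ih (hc.add (isConnector_singleton K k) hwM
        ⟨k, Multiset.mem_singleton_self k, hwk⟩) R (by simpa using hn)
      exact ⟨M', R', c', by rw [h, add_assoc, Multiset.singleton_add], h'⟩

variable (K) in
theorem exists_isConnector {L : Multiset σ} (hL : L ≠ 0) : ∃ M R c, M + R = L ∧
    IsConnector K M c ∧ Disjoint (lowerSupport M) (lowerSupport R) := by
  obtain ⟨k, hk⟩ := Multiset.exists_mem_of_ne_zero hL
  obtain ⟨R, rfl⟩ := Multiset.exists_cons_of_mem hk
  simpa only [Multiset.singleton_add] using (isConnector_singleton K k).exists_disjoint R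

/-- The annihilator of the class of `x ^ c * x ^ R` is this prime: the connector gives one
inclusion. For the other, the monomial is outside the block product, having degree at most `card M -
1` in the block's variables. -/
theorem IsConnector.mem_associatedPrimes {M R : Multiset σ} {c : σ →₀ ℕ}
    (hc : IsConnector K M c) (hMR : Disjoint (lowerSupport M) (lowerSupport R)) :
    Ideal.span (X '' lowerSupport M) ∈
      associatedPrimes (MvPolynomial σ K) (MvPolynomial σ K ⧸ lowerProduct K (M + R)) := by
  have hP := isPrime_span_X_image (K := K) (lowerSupport M)
  have hg : monomial (c + exponentOf R) (1 : K) ∉ lowerProduct K M := fun h => by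
    rw [add_comm] at h
    have := (isGeneratedIn_lowerProduct M).le_degree
      ((isGeneratedIn_lowerProduct M).monomial_mem_of_add
        (fun v hv => exponentOf_apply_eq_zero (Set.disjoint_left.1 hMR hv)) h)
    have := hc.1
    omega
  refine ⟨hP, Ideal.Quotient.mk _ (monomial (c + exponentOf R) 1), ?_⟩
  -- Associated primes are defined as radicals of annihilators; here the annihilator is already
  -- prime.
  rw [← hP.radical]
  congr 1
  ext f
  rw [Submodule.mem_colon_singleton, Submodule.mem_bot]
  change _ ↔ Ideal.Quotient.mk _ (f * monomial (c + exponentOf R) 1) = 0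
  rw [Ideal.Quotient.eq_zero_iff_mem, lowerProduct_add]
  refine ⟨fun hf => ?_, fun hf => ?_⟩
  · induction hf using Submodule.span_induction with
    | zero => simp
    | add x y _ _ hx hy => rw [add_mul]; exact Ideal.add_mem _ hx hy
    | smul a x _ hx => rw [smul_eq_mul, mul_assoc]; exact Ideal.mul_mem_left _ a hx
    | mem x hx =>
      obtain ⟨v, hv, rfl⟩ := hx
      have := Ideal.mul_mem_mul (hc.2 v hv) (monomial_exponentOf_mem (K := K) R)
      rw [monomial_mul, one_mul] at this
      rw [X, monomial_mul, one_mul]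
      convert this using 3
      abel
  · by_contra h
    have hf' : f * monomial (c + exponentOf R) 1 ∈ lowerProduct K M := Ideal.mul_le_left hf
    exact hg ((isGeneratedIn_lowerProduct M).mem_of_mul_mem h hf')

/-- One block is split off `L` at a time; `L'` carries the factors already split off, so the
symbolic power always refers to the full product. -/
theorem symbolicPower_lowerProduct_le_pow (d : ℕ) {L L' : Multiset σ}
    (h : Disjoint (lowerSupport L) (lowerSupport L')) :
    symbolicPower (lowerProduct K (L + L')) d ≤ lowerProduct K L ^ d := by
  induction hn : L.card using Nat.strong_induction_on generalizing L L' with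
  | _ n ih =>
    rcases eq_or_ne L 0 with rfl | hL
    · simp [lowerProduct, Ideal.top_pow]
    · obtain ⟨M, R, c, rfl, hc, hMR⟩ := exists_isConnector K hL
      rw [lowerSupport_add, Set.disjoint_union_left] at h
      have hM : Disjoint (lowerSupport M) (lowerSupport (R + L')) := by
        rw [lowerSupport_add, Set.disjoint_union_right]
        exact ⟨hMR, h.1⟩
      have hR : Disjoint (lowerSupport R) (lowerSupport (M + L')) := by
        rw [lowerSupport_add, Set.disjoint_union_right]
        exact ⟨hMR.symm, h.2⟩
      have hcard : R.card < n := by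
        -- A block is nonempty, its cardinality being `c.degree + 1`.
        rw [← hn, Multiset.card_add, ← hc.1]
        omega
      have h1 := ih _ hcard hR rfl
      rw [show R + (M + L') = M + R + L' by abel] at h1
      have h2 : symbolicPower (lowerProduct K (M + R + L')) d ≤ lowerProduct K M ^ d := by
        intro f hf
        have hP := hc.mem_associatedPrimes hM
        rw [← add_assoc] at hP
        have : (Ideal.span (X '' lowerSupport M : Set (MvPolynomial σ K))).IsPrime := hP.1
        have hf' := (Submodule.mem_iInf _).1 hf ⟨_, hP⟩
        rw [Ideal.mem_comap, IsLocalization.algebraMap_mem_map_algebraMap_iff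
          (Ideal.span (X '' lowerSupport M : Set (MvPolynomial σ K))).primeCompl] at hf'
        obtain ⟨s, hs, hsf⟩ := hf'
        refine ((isGeneratedIn_lowerProduct M).pow d).mem_of_mul_mem hs ?_
        refine Ideal.pow_right_mono ?_ d hsf
        rw [lowerProduct_add, lowerProduct_add]
        exact Ideal.mul_le_left.trans Ideal.mul_le_left
      rw [lowerProduct_add M R, mul_pow]
      exact (le_inf h2 h1).trans (((isGeneratedIn_lowerProduct M).pow d).inf_le_mul
        ((isGeneratedIn_lowerProduct R).pow d) hMR)

end Blocks

/-! ### The three invariants -/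

section Main

theorem pow_le_symbolicPower {S : Type*} [CommRing S] (I : Ideal S) (d : ℕ) :
    I ^ d ≤ symbolicPower I d :=
  le_iInf fun _ => Ideal.le_comap_map

theorem symbolicDefect_eq_zero {S : Type*} [CommRing S] {I : Ideal S} {d : ℕ}
    (h : symbolicPower I d = I ^ d) : symbolicDefect I d = 0 := by
  have : Subsingleton (symbolicPower I d ⧸ (I ^ d).submoduleOf (symbolicPower I d)) := by
    rw [Submodule.Quotient.subsingleton_iff, Submodule.submoduleOf_eq_top, h]
  rw [symbolicDefect, Subsingleton.elim (⊤ : Submodule S _) ⊥]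
  exact Submodule.spanRank_eq_zero_iff_eq_bot.2 rfl

variable {K : Type*} [Field K] {σ : Type*} [PartialOrder σ]

variable (K) in
theorem symbolicPower_principalQBorel (m : σ →₀ ℕ) (d : ℕ) :
    symbolicPower (principalQBorel K m) d = principalQBorel K m ^ d := by
  refine le_antisymm ?_ (pow_le_symbolicPower _ d)
  rw [principalQBorel_eq_lowerProduct]
  simpa only [add_zero] using symbolicPower_lowerProduct_le_pow (K := K) d
    (L := m.toMultiset) (L' := 0) (by simp [lowerSupport])

variable (K) in
theorem isGeneratedIn_principalQBorel (m : σ →₀ ℕ) :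
    IsGeneratedIn Set.univ m.degree (principalQBorel K m) := by
  rw [principalQBorel_eq_lowerProduct]
  have h := (isGeneratedIn_lowerProduct (K := K) m.toMultiset).mono (Set.subset_univ _)
  rwa [Finsupp.card_toMultiset] at h

variable (K) in
theorem principalQBorel_ne_bot (m : σ →₀ ℕ) : principalQBorel K m ≠ ⊥ := fun h => by
  have := (isLeast_principalQBorel (K := K) m).1.2
  rw [h, Ideal.mem_bot, monomial_eq_zero] at this
  exact one_ne_zero this

variable (K) in
theorem initialDegree_principalQBorel_pow (m : σ →₀ ℕ) (d : ℕ) :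
    initialDegree (principalQBorel K m ^ d) = d * m.degree :=
  ((isGeneratedIn_principalQBorel K m).pow d).initialDegree_eq
    (pow_ne_zero d (principalQBorel_ne_bot K m))

theorem isWaldschmidtConstant_principalQBorel (m : σ →₀ ℕ) :
    IsWaldschmidtConstant (principalQBorel K m) (m.degree : ℝ) := by
  refine tendsto_const_nhds.congr' ?_
  filter_upwards [eventually_ge_atTop 1] with s hs
  have : (s : ℝ) ≠ 0 := by positivity
  rw [symbolicPower_principalQBorel, initialDegree_principalQBorel_pow]
  push_cast
  field_simp

/-- Comparing the degree of `x ^ (s • m)` with that of the generators of the `r`-th power gives `r ≤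
s`, as `deg m > 0`. -/
theorem principalQBorel_pow_le_pow_iff {m : σ →₀ ℕ} (hm : m ≠ 0) {s r : ℕ} :
    principalQBorel K m ^ s ≤ principalQBorel K m ^ r ↔ r ≤ s := by
  refine ⟨fun h => ?_, fun h => Ideal.pow_le_pow_right h⟩
  have h1 : monomial (s • m) (1 : K) ∈ principalQBorel K m ^ s := by
    simpa [monomial_pow] using
      Ideal.pow_mem_pow (isLeast_principalQBorel (K := K) m).1.2 s
  have h2 := ((isGeneratedIn_principalQBorel K m).pow r).le_degree (h h1)
  rw [map_nsmul, smul_eq_mul] at h2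
  exact Nat.le_of_mul_le_mul_right h2
    (Nat.pos_of_ne_zero fun h => hm ((Finsupp.degree_eq_zero_iff m).1 h))

/-- Non-containment means `s < r`, so every quotient is below 1, while `n / (n + 1)` tends to 1. -/
theorem resurgence_principalQBorel {m : σ →₀ ℕ} (hm : m ≠ 0) :
    resurgence (principalQBorel K m) = 1 := by
  have key : ∀ s r : ℕ, ¬ symbolicPower (principalQBorel K m) s ≤ principalQBorel K m ^ r ↔
      s < r := fun s r => by
    rw [symbolicPower_principalQBorel, principalQBorel_pow_le_pow_iff hm, not_le]
  refine le_antisymm (sSup_le ?_) (le_of_forall_lt fun c hc => ?_)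
  · rintro _ ⟨s, r, hs, hr, h, rfl⟩
    rw [key] at h
    rw [← EReal.coe_one, EReal.coe_le_coe_iff]
    exact div_le_one_of_le₀ (by exact_mod_cast h.le) (by positivity)
  · have hlim : Tendsto (fun n : ℕ => (((n / (n + 1 : ℝ)) : ℝ) : EReal)) atTop (𝓝 1) :=
      (continuous_coe_real_ereal.tendsto 1).comp (tendsto_natCast_div_add_atTop (1 : ℝ))
    obtain ⟨n, hcn, hn⟩ := ((hlim.eventually (lt_mem_nhds hc)).and (eventually_ge_atTop 1)).exists
    refine hcn.trans_le (le_sSup ⟨n, n + 1, hn, by omega, ?_, by push_cast; rfl⟩)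
    exact (key n (n + 1)).2 n.lt_succ_self

end Main

end QBorel

theorem mainTheorem5 {K : Type*} [Field K] {σ : Type*} [Finite σ] [PartialOrder σ]
    (m : σ →₀ ℕ) :
    QBorel.IsWaldschmidtConstant (QBorel.principalQBorel K m) (m.degree : ℝ) ∧
    (∀ d : ℕ, 1 ≤ d → QBorel.symbolicDefect (QBorel.principalQBorel K m) d = 0) ∧
    (m ≠ 0 → QBorel.resurgence (QBorel.principalQBorel K m) = 1) :=
  ⟨QBorel.isWaldschmidtConstant_principalQBorel m,
    fun d _ => QBorel.symbolicDefect_eq_zero (QBorel.symbolicPower_principalQBorel K m d),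
    fun hm => QBorel.resurgence_principalQBorel hm⟩
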